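/- Let $T>0$ and $n\in\mathbb N$, let $|\cdot|$ be the Euclidean norm on $\mathbb R^n$, and let $F:[0,T]\times\mathbb R^n\rightrightarrows\mathbb R^n$ be a set-valued mapping. Write $\operatorname{dom}F(t,\cdot)=\{x: F(t,x)\neq\emptyset\}$ and $\operatorname{graph}F(t,\cdot)=\{(x,y): y\in F(t,x)\}$. Assume: (A1) For each $t\in[0,T]$ the mapping $F(t,\cdot)$ is maximal monotone, i.e. $\langle x_1-x_2,y_1-y_2\rangle\ge 0$ for all $(x_1,y_1),(x_2,y_2)\in\operatorname{graph}F(t,\cdot)$, and no proper superset of $\operatorname{graph}F(t,\cdot)$ in $\mathbb R^n\times\mathbb R^n$ has this property. (A2) There is a nondecreasing absolutely continuous function $\varphi:[0,T]\to\mathbb R$ such that $$\sup_{z\in\operatorname{dom}F(s,\cdot)}\operatorname{dist}\bigl(z,\operatorname{dom}F(t,\cdot)\bigr)\le\varphi(t)-\varphi(s)\qquad\text{for all }0\le s\le t\le T .$$ (A3) For every $r>0$ there is an integrable function $\sigma_r:[0,T]\to[0,\infty)$ such that $|F^0(t,x)|\le\sigma_r(t)(1+|x|)$ for all $t\in[0,T]$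 and all $x\in\operatorname{dom}F(t,\cdot)$ with $|x|\le r$, where $F^0(t,x)$ denotes the element of least norm of the closed convex set $F(t,x)$. (A4) The set-valued mapping $t\mapsto\operatorname{graph}F(t,\cdot)$ is outer semicontinuous on $[0,T]$: if $t_\ell\in[0,T]$, $y_\ell\in F(t_\ell,x_\ell)$ and $(t_\ell,x_\ell,y_\ell)\to(t,x,y)$, then $y\in F(t,x)$. Then for every $x_0\in\operatorname{cl}\bigl(\operatorname{dom}F(0,\cdot)\bigr)$ there is exactly one absolutely continuous function $x:[0,T]\to\mathbb R^n$ such that $x(0)=x_0$ and, for almost every $t\in[0,T]$, $x(t)\in\operatorname{dom}F(t,\cdot)$ and $$\dot x(t)\in-F\bigl(t,x(t)\bigr).$$ -/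

import Mathlib

open Set Filter Topology MeasureTheory

namespace MonotoneInclusion

section Operators

variable {E : Type*} [NormedAddCommGroup E] [InnerProductSpace ℝ E]

/-- The domain of a set-valued mapping. -/
def dom (A : E → Set E) : Set E := {x | (A x).Nonempty}

/-- The graph of a set-valued mapping. -/
def graph (A : E → Set E) : Set (E × E) := {p | p.2 ∈ A p.1}

/-- Monotonicity of a subset of `E × E`. -/
def IsMonotoneSet (S : Set (E × E)) : Prop :=
  ∀ p ∈ S, ∀ q ∈ S, 0 ≤ inner ℝ (p.1 - q.1) (p.2 - q.2)

/-- A set-valued mapping is maximal monotone if its graph is monotone and no proper enlargement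
of the graph in `E × E` is monotone. -/
def IsMaximalMonotone (A : E → Set E) : Prop :=
  IsMonotoneSet (graph A) ∧
    ∀ S : Set (E × E), IsMonotoneSet S → graph A ⊆ S → S = graph A

/-- The projection of `x` onto `S`: a point of `S` at distance `dist (x, S)` from `x`. It exists
and is unique when `S` is nonempty, closed and convex (and `E` is complete); the value is arbitrary
when there is no such point. -/
noncomputable def proj (x : E) (S : Set E) : E :=
  Classical.epsilon fun y => y ∈ S ∧ dist x y = Metric.infDist x S

/-- The minimal section `A⁰(x) = proj (0, A(x))`. -/
noncomputable def minimalSection (A : E → Set E) (x : E) : E := proj 0 (A x)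

/-- `(x, y)` is in the graph of a maximal monotone mapping as soon as it is monotonically related
to the graph. -/
theorem IsMaximalMonotone.mem_of_forall {A : E → Set E} (hA : IsMaximalMonotone A) {x y : E}
    (h : ∀ u, ∀ v ∈ A u, 0 ≤ inner ℝ (x - u) (y - v)) : y ∈ A x := by
  have hS : IsMonotoneSet (insert (x, y) (graph A)) := by
    intro p hp q hq
    rcases hp with rfl | hp <;> rcases hq with rfl | hq
    · simp
    · exact h q.1 q.2 hq
    · have := h p.1 p.2 hp
      rw [← neg_sub x, ← neg_sub y, inner_neg_neg]
      exact this
    · exact hA.1 p hp q hq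
  have h2 := hA.2 _ hS (subset_insert _ _)
  have h3 : (x, y) ∈ graph A := by
    rw [← h2]
    exact mem_insert _ _
  exact h3

/-- The values of a maximal monotone mapping as intersections of closed half-spaces. -/
theorem IsMaximalMonotone.eq_setOf {A : E → Set E} (hA : IsMaximalMonotone A) (x : E) :
    A x = {y | ∀ u, ∀ v ∈ A u, 0 ≤ inner ℝ (x - u) (y - v)} := by
  ext y
  exact ⟨fun hy u v hv => hA.1 (x, y) hy (u, v) hv, fun h => hA.mem_of_forall h⟩

theorem IsMaximalMonotone.isClosed {A : E → Set E} (hA : IsMaximalMonotone A) (x : E) :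
    IsClosed (A x) := by
  rw [hA.eq_setOf x]
  simp only [ofPred_forall]
  refine isClosed_iInter fun u => isClosed_iInter fun v => isClosed_iInter fun _ => ?_
  exact isClosed_le continuous_const (by fun_prop)

theorem IsMaximalMonotone.convex {A : E → Set E} (hA : IsMaximalMonotone A) (x : E) :
    Convex ℝ (A x) := by
  intro y hy z hz a b ha hb hab
  refine hA.mem_of_forall fun u v hv => ?_
  have h1 := hA.1 (x, y) hy (u, v) hv
  have h2 := hA.1 (x, z) hz (u, v) hv
  have h3 : a • y + b • z - v = a • (y - v) + b • (z - v) := by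
    have : v = (a + b) • v := by rw [hab, one_smul]
    rw [smul_sub, smul_sub]
    nth_rewrite 1 [this]
    rw [add_smul]
    abel
  rw [h3, inner_add_right, inner_smul_right, inner_smul_right]
  exact add_nonneg (mul_nonneg ha h1) (mul_nonneg hb h2)

theorem IsMaximalMonotone.dom_nonempty {A : E → Set E} (hA : IsMaximalMonotone A) :
    (dom A).Nonempty := by
  by_contra hne
  have hempty : ∀ u, ∀ v, v ∉ A u := fun u v hv => hne ⟨u, v, hv⟩
  exact hempty 0 0 (hA.mem_of_forall fun u v hv => absurd hv (hempty u v))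

/-- The minimal section is the least-norm element of the value. -/
theorem IsMaximalMonotone.minimalSection_spec [ProperSpace E] {A : E → Set E}
    (hA : IsMaximalMonotone A) {x : E} (hx : x ∈ dom A) :
    minimalSection A x ∈ A x ∧ ∀ y ∈ A x, ‖minimalSection A x‖ ≤ ‖y‖ := by
  have hex : ∃ y, y ∈ A x ∧ dist 0 y = Metric.infDist 0 (A x) := by
    obtain ⟨y, hy, h⟩ := (hA.isClosed x).exists_infDist_eq_dist hx 0
    exact ⟨y, hy, h.symm⟩
  have hs := Classical.epsilon_spec hex
  refine ⟨hs.1, fun y hy => ?_⟩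
  have h1 := Metric.infDist_le_dist_of_mem (x := (0 : E)) hy
  have h2 : dist 0 (minimalSection A x) = Metric.infDist 0 (A x) := hs.2
  rw [← h2, dist_zero_left, dist_zero_left] at h1
  exact h1

end Operators

/-- The outer limit at `tstar` of a set-valued mapping `G` on `[0, T]`: all limits of sequences
`y l ∈ G (t l)` along sequences `t l → tstar` in `[0, T]`. -/
def outerLimit {X : Type*} [TopologicalSpace X] (T : ℝ) (G : ℝ → Set X) (tstar : ℝ) : Set X :=
  {y | ∃ (t : ℕ → ℝ) (w : ℕ → X), (∀ l, t l ∈ Icc 0 T ∧ w l ∈ G (t l)) ∧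
    Tendsto t atTop (𝓝 tstar) ∧ Tendsto w atTop (𝓝 y)}

/-- Outer semicontinuity on `[0, T]`. -/
def OuterSemicontinuous {X : Type*} [TopologicalSpace X] (T : ℝ) (G : ℝ → Set X) : Prop :=
  ∀ tstar ∈ Icc 0 T, outerLimit T G tstar ⊆ G tstar

section Inclusion

variable {n : ℕ}

/-- Each domain `dom F(s, ·)` lies within `φ(t) - φ(s)` of `dom F(t, ·)` for `s ≤ t`, for some
nondecreasing absolutely continuous `φ`. -/
def DomainExcessBound (T : ℝ)
    (F : ℝ → EuclideanSpace ℝ (Fin n) → Set (EuclideanSpace ℝ (Fin n))) : Prop :=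
  ∃ φ : ℝ → ℝ, MonotoneOn φ (Icc 0 T) ∧ AbsolutelyContinuousOnInterval φ 0 T ∧
    ∀ s t : ℝ, 0 ≤ s → s ≤ t → t ≤ T →
      ∀ z ∈ dom (F s), Metric.infDist z (dom (F t)) ≤ φ t - φ s

/-- Linear growth of the minimal section, locally in `x`, with an integrable coefficient. -/
def MinimalSectionGrowth (T : ℝ)
    (F : ℝ → EuclideanSpace ℝ (Fin n) → Set (EuclideanSpace ℝ (Fin n))) : Prop :=
  ∀ r : ℝ, 0 < r → ∃ σ : ℝ → ℝ, IntegrableOn σ (Icc 0 T) ∧ (∀ t ∈ Icc 0 T, 0 ≤ σ t) ∧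
    ∀ t ∈ Icc 0 T, ∀ x ∈ Metric.closedBall 0 r ∩ dom (F t),
      ‖minimalSection (F t) x‖ ≤ σ t * (1 + ‖x‖)

/-- `x` is an absolutely continuous solution on `[0, T]` of `x'(t) ∈ -F(t, x(t))`, `x(0) = x₀`. -/
def IsSolution (T : ℝ)
    (F : ℝ → EuclideanSpace ℝ (Fin n) → Set (EuclideanSpace ℝ (Fin n)))
    (x₀ : EuclideanSpace ℝ (Fin n)) (x : ℝ → EuclideanSpace ℝ (Fin n)) : Prop :=
  AbsolutelyContinuousOnInterval x 0 T ∧ x 0 = x₀ ∧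
    ∀ᵐ t ∂(volume.restrict (Icc 0 T)),
      x t ∈ dom (F t) ∧ DifferentiableAt ℝ x t ∧ -deriv x t ∈ F t (x t)

end Inclusion

end MonotoneInclusion

namespace MonotoneInclusion

/-! ### Minty's theorem by minimax -/

section Resolvent

variable {E : Type*} [NormedAddCommGroup E] [InnerProductSpace ℝ E]

/-! Uniqueness is monotonicity: the squared distance of two solutions is absolutely continuous with
nonpositive derivative (`IsSolution.eqOn`).

Existence comes from an implicit Euler scheme whose resolvents exist by Minty's theorem
(`IsMaximalMonotone.exists_resolvent`). The growth coefficients are only integrable, so values at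
grid points carry no information. Each cell is therefore sampled at a time where a combined
coefficient is at most its mean. A reference sequence following the moving domains gives a priori
bounds, and the increments are then dominated by integrals of one fixed integrable density `g`
(`exists_proximal_scheme`). Limits along an ultrafilter inherit this domination and are absolutely
continuous.

The velocities need not be bounded. At almost every `t` the monotonicity inequality against each
graph point of `F t` is summed over the steps in `[t, t + δ]`. Slow steps are handled by outer
semicontinuity (`OuterSemicontinuous.exists_pos_forall_le_inner`). Fast steps cost at most a
multiple of the integral of `max (g - C) 0` (`IsProximalScheme.le_inner_sub`), which is `o(δ)` at a
Lebesgue point with `C ≥ g t`. Maximality then puts `-x' t` in `F t (x t)`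
(`neg_deriv_mem_of_tendsto`). -/

theorem convexOn_inner_sub_sub (u w : E) :
    ConvexOn ℝ univ fun x : E => inner ℝ (x - u) (x - w) := by
  refine ⟨convex_univ, fun x _ y _ a b ha hb hab => ?_⟩
  have e1 : ∀ c : E, a • x + b • y - c = a • (x - c) + b • (y - c) := fun c => by
    have : c = (a + b) • c := by rw [hab, one_smul]
    nth_rewrite 1 [this]
    module
  have e2 : inner ℝ ((x - u) - (y - u)) ((x - w) - (y - w)) = ‖x - y‖ ^ 2 := by
    rw [sub_sub_sub_cancel_right, sub_sub_sub_cancel_right, real_inner_self_eq_norm_sq]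
  have e3 : 0 ≤ a * b * ‖x - y‖ ^ 2 := by positivity
  simp only [e1, inner_add_left, inner_add_right, inner_smul_left, inner_smul_right,
    smul_eq_mul, RCLike.conj_to_real]
  rw [← e2, inner_sub_left, inner_sub_right _ (x - w), inner_sub_right _ (x - w)] at e3
  have hb' : b = 1 - a := by linarith
  subst hb'
  linarith

/-- Symmetrising in `i` and `j` turns twice the sum into `∑ b i * b j * ⟨u i - u j, w i - w j⟩`.
This bounds the saddle value at the barycentre. -/
theorem sum_mul_inner_sub_nonpos {ι : Type*} [Fintype ι] {u w : ι → E}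
    (h : ∀ i j, inner ℝ (u i - u j) (w i - w j) ≤ 0) {b : ι → ℝ} (hb : b ∈ stdSimplex ℝ ι) :
    ∑ i, b i * inner ℝ ((∑ j, b j • u j) - u i) ((∑ j, b j • u j) - w i) ≤ 0 := by
  set c := ∑ j, b j • u j with hc
  have h0 : ∑ i, b i * inner ℝ (c - u i) c = 0 := by
    have : ∑ i, b i • (c - u i) = 0 := by
      simp only [smul_sub, Finset.sum_sub_distrib, ← Finset.sum_smul, hb.2, one_smul]
      rw [← hc, sub_self]
    calc _ = inner ℝ (∑ i, b i • (c - u i)) c := by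
          simp [sum_inner, inner_smul_left]
      _ = 0 := by rw [this, inner_zero_left]
  have hS : ∑ i, b i * inner ℝ (c - u i) (c - w i)
      = ∑ i, ∑ j, b i * b j * (inner ℝ (u i) (w i) - inner ℝ (u j) (w i)) := by
    have h1 : ∀ i, ∑ j, b i * b j * (inner ℝ (u i) (w i) - inner ℝ (u j) (w i))
        = - (b i * inner ℝ (c - u i) (w i)) := fun i => by
      have h2 : inner ℝ c (w i) = ∑ j, b j * inner ℝ (u j) (w i) := by
        simp [hc, sum_inner, inner_smul_left]
      have h3 : inner ℝ (u i) (w i) = ∑ j, b j * inner ℝ (u i) (w i) := by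
        rw [← Finset.sum_mul, hb.2, one_mul]
      rw [inner_sub_left, h2]
      nth_rewrite 2 [h3]
      rw [← Finset.sum_sub_distrib, Finset.mul_sum, ← Finset.sum_neg_distrib]
      exact Finset.sum_congr rfl fun j _ => by ring
    rw [Finset.sum_congr rfl fun i _ => h1 i]
    simp only [inner_sub_right _ c, mul_sub, Finset.sum_sub_distrib, h0, Finset.sum_neg_distrib,
      zero_sub]
  have hS' : ∑ i, ∑ j, b i * b j * (inner ℝ (u i) (w i) - inner ℝ (u j) (w i))
      = ∑ i, ∑ j, b i * b j * (inner ℝ (u j) (w j) - inner ℝ (u i) (w j)) := by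
    rw [Finset.sum_comm]
    exact Finset.sum_congr rfl fun i _ => Finset.sum_congr rfl fun j _ => by ring
  have h2S : ∑ i, ∑ j, b i * b j * (inner ℝ (u i) (w i) - inner ℝ (u j) (w i))
      + ∑ i, ∑ j, b i * b j * (inner ℝ (u j) (w j) - inner ℝ (u i) (w j)) ≤ 0 := by
    simp only [← Finset.sum_add_distrib]
    refine Finset.sum_nonpos fun i _ => Finset.sum_nonpos fun j _ => ?_
    have h4 := mul_nonpos_of_nonneg_of_nonpos (mul_nonneg (hb.1 i) (hb.1 j)) (h i j)
    rw [inner_sub_left, inner_sub_right, inner_sub_right] at h4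
    linarith
  rw [hS]
  linarith

/-- Finitely many balls with diameters `[u i, w i]` have a common point as soon as the
pairs `(u i, w i)` are antimonotone. -/
theorem exists_forall_inner_sub_sub_nonpos {ι : Type*} [Finite ι] {u w : ι → E}
    (h : ∀ i j, inner ℝ (u i - u j) (w i - w j) ≤ 0) :
    ∃ x, ∀ i, inner ℝ (x - u i) (x - w i) ≤ 0 := by
  classical
  have := Fintype.ofFinite ι
  rcases isEmpty_or_nonempty ι with hι | ⟨⟨i₀⟩⟩
  · exact ⟨0, fun i => hι.elim i⟩
  -- At a saddle point `(a, b)`, the value at `a` and a vertex of the simplex is at most the value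
  -- at `b` and the barycentre `∑ b j • u j`, which is nonpositive.
  obtain ⟨a, -, b, hb, hab⟩ := Sion.exists_isSaddlePointOn (X := convexHull ℝ (range u))
    (Y := stdSimplex ℝ ι) (f := fun x b => ∑ i, b i * inner ℝ (x - u i) (x - w i))
    ⟨u i₀, subset_convexHull ℝ _ (mem_range_self i₀)⟩ (convex_convexHull ℝ _)
    ((finite_range u).isCompact_convexHull ℝ)
    (fun b _ => Continuous.lowerSemicontinuous (by fun_prop) |>.lowerSemicontinuousOn _)
    (fun b hb => by
      refine ConvexOn.quasiconvexOn ⟨convex_convexHull ℝ _, fun x _ y _ s t hs ht hst => ?_⟩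
      simp only [smul_eq_mul, Finset.mul_sum, ← Finset.sum_add_distrib]
      refine Finset.sum_le_sum fun i _ => ?_
      have h1 := (convexOn_inner_sub_sub (u i) (w i)).2 (mem_univ x) (mem_univ y) hs ht hst
      have h2 := mul_le_mul_of_nonneg_left h1 (hb.1 i)
      simp only [smul_eq_mul] at h2
      linarith)
    (convex_stdSimplex ℝ ι) ⟨_, single_mem_stdSimplex ℝ i₀⟩ (isCompact_stdSimplex ℝ ι)
    (fun x _ => Continuous.upperSemicontinuous (by fun_prop) |>.upperSemicontinuousOn _)
    (fun x _ => by
      refine ConcaveOn.quasiconcaveOn ⟨convex_stdSimplex ℝ ι, fun p _ q _ s t _ _ _ => le_of_eq ?_⟩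
      simp [add_mul, Finset.sum_add_distrib, Finset.mul_sum, mul_assoc])
  refine ⟨a, fun i => ?_⟩
  have hc : ∑ j, b j • u j ∈ convexHull ℝ (range u) :=
    (convex_convexHull ℝ _).sum_mem (fun j _ => hb.1 j) hb.2
      fun j _ => subset_convexHull ℝ _ (mem_range_self j)
  have h1 := hab _ hc _ (single_mem_stdSimplex ℝ i)
  have h2 := sum_mul_inner_sub_nonpos h hb
  simp only [Pi.single_apply, ite_mul, one_mul, zero_mul, Finset.sum_ite_eq', Finset.mem_univ,
    if_true] at h1
  exact h1.trans h2

theorem isCompact_setOf_inner_sub_sub_nonpos [ProperSpace E] (u w : E) :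
    IsCompact {x : E | inner ℝ (x - u) (x - w) ≤ 0} := by
  refine Metric.isCompact_of_isClosed_isBounded
    (isClosed_le (by fun_prop) continuous_const) ?_
  refine (Metric.isBounded_closedBall (x := u) (r := ‖u - w‖)).subset fun x hx => ?_
  rw [mem_ofPred_eq] at hx
  rw [mem_closedBall_iff_norm]
  have h1 : x - w = (x - u) + (u - w) := by abel
  rw [h1, inner_add_right, real_inner_self_eq_norm_sq] at hx
  have h2 := neg_le_of_abs_le (abs_real_inner_le_norm (x - u) (u - w))
  by_contra! h3
  have := norm_nonneg (u - w)
  nlinarith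

/-- Minty's theorem: the resolvents of a maximal monotone mapping are everywhere defined. -/
theorem IsMaximalMonotone.exists_resolvent [ProperSpace E] {A : E → Set E}
    (hA : IsMaximalMonotone A) {c : ℝ} (hc : 0 < c) (z : E) :
    ∃ x, c⁻¹ • (z - x) ∈ A x := by
  -- By maximality the resolvent equation says that `x` lies in every ball with diameter `[u, z - c
  -- • v]`, `(u, v)` in the graph. Compactness reduces this to finitely many balls.
  have key : (⋂ p : graph A, {x : E | inner ℝ (x - p.1.1) (x - (z - c • p.1.2)) ≤ 0}).Nonempty := by
    obtain ⟨u₀, v₀, hv₀⟩ := hA.dom_nonempty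
    have hne : Nonempty (graph A) := ⟨⟨(u₀, v₀), hv₀⟩⟩
    by_contra hemp
    rw [not_nonempty_iff_eq_empty] at hemp
    obtain ⟨s, hs⟩ := (isCompact_setOf_inner_sub_sub_nonpos u₀
      (z - c • v₀)).elim_finite_subfamily_closed
      (fun p : graph A => {x : E | inner ℝ (x - p.1.1) (x - (z - c • p.1.2)) ≤ 0})
      (fun p => isClosed_le (by fun_prop) continuous_const) (by rw [hemp, inter_empty])
    -- The index `none` carries the reference ball that supplies compactness.
    let q : Option s → E × E := fun o => o.elim (u₀, v₀) fun p => p.1.1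
    have hq : ∀ o, q o ∈ graph A := by
      rintro (_ | p)
      · exact hv₀
      · exact p.1.2
    have hfin := exists_forall_inner_sub_sub_nonpos (u := fun o => (q o).1)
      (w := fun o => z - c • (q o).2) fun i j => by
        have h1 := mul_nonneg hc.le (hA.1 _ (hq i) _ (hq j))
        rw [sub_sub_sub_cancel_left, ← smul_sub, inner_smul_right, ← neg_sub (q i).2,
          inner_neg_right]
        linarith
    obtain ⟨x, hx⟩ := hfin
    have : x ∈ (∅ : Set E) := by
      rw [← hs]
      refine ⟨hx none, mem_iInter₂.2 fun p hp => hx (some ⟨p, hp⟩)⟩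
    exact this
  obtain ⟨x, hx⟩ := key
  refine ⟨x, hA.mem_of_forall fun u v hv => ?_⟩
  have h1 : inner ℝ (x - u) (x - (z - c • v)) ≤ 0 := mem_iInter.1 hx ⟨(u, v), hv⟩
  have h2 : c⁻¹ • (z - x) - v = -(c⁻¹ • (x - (z - c • v))) := by
    rw [smul_sub, smul_sub, smul_sub, smul_smul, inv_mul_cancel₀ hc.ne', one_smul]
    abel
  rw [h2, inner_neg_right, inner_smul_right]
  have := mul_nonpos_of_nonneg_of_nonpos (inv_pos.2 hc).le h1
  linarith

/-- A resolvent step from `z` compared with a point `p` of the graph. -/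
theorem IsMaximalMonotone.norm_resolvent_sub_le {A : E → Set E} (hA : IsMaximalMonotone A)
    {c : ℝ} (hc : 0 < c) {x z p w : E} (hx : c⁻¹ • (z - x) ∈ A x) (hw : w ∈ A p) :
    ‖x - p‖ ≤ ‖z - p‖ + c * ‖w‖ := by
  have h1 := hA.1 (x, _) hx (p, w) hw
  have h2 : c⁻¹ • (z - x) - w = c⁻¹ • ((z - p - c • w) - (x - p)) := by
    rw [smul_sub, smul_sub, smul_sub, smul_sub, smul_sub, smul_smul, inv_mul_cancel₀ hc.ne',
      one_smul]
    abel
  simp only [h2, inner_smul_right] at h1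
  have h3 := nonneg_of_mul_nonneg_right h1 (inv_pos.2 hc)
  rw [inner_sub_right, real_inner_self_eq_norm_sq] at h3
  have h4 := real_inner_le_norm (x - p) (z - p - c • w)
  have h5 : ‖z - p - c • w‖ ≤ ‖z - p‖ + c * ‖w‖ := by
    refine (norm_sub_le _ _).trans ?_
    rw [norm_smul, Real.norm_of_nonneg hc.le]
  by_contra! h6
  have := norm_nonneg (z - p - c • w)
  nlinarith

end Resolvent

/-! ### Absolutely continuous functions -/

section AbsolutelyContinuous

theorem absolutelyContinuousOnInterval_of_dist_le {X Y : Type*} [PseudoMetricSpace X]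
    [PseudoMetricSpace Y] {f : ℝ → X} {g : ℝ → Y} {a b K : ℝ}
    (hg : AbsolutelyContinuousOnInterval g a b)
    (h : ∀ s ∈ uIcc a b, ∀ t ∈ uIcc a b, dist (f s) (f t) ≤ K * dist (g s) (g t)) :
    AbsolutelyContinuousOnInterval f a b := by
  have h1 : Tendsto (fun I : ℕ × (ℕ → ℝ × ℝ) =>
      K * ∑ i ∈ Finset.range I.1, dist (g (I.2 i).1) (g (I.2 i).2))
      (AbsolutelyContinuousOnInterval.totalLengthFilter ⊓
        𝓟 (AbsolutelyContinuousOnInterval.disjWithin a b)) (𝓝 0) := by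
    simpa using Tendsto.const_mul K hg
  refine squeeze_zero' (Eventually.of_forall fun I => Finset.sum_nonneg fun _ _ => dist_nonneg)
    ?_ h1
  refine (eventually_inf_principal.2 (Eventually.of_forall fun I hI => ?_))
  rw [Finset.mul_sum]
  exact Finset.sum_le_sum fun i hi => h _ (hI.1 i hi).1 _ (hI.1 i hi).2

theorem le_of_ae_deriv_nonpos {f : ℝ → ℝ} {a b : ℝ} (hab : a ≤ b)
    (hf : AbsolutelyContinuousOnInterval f a b)
    (h : ∀ᵐ t ∂volume.restrict (Icc a b), deriv f t ≤ 0) : f b ≤ f a := by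
  have h1 := hf.integral_deriv_eq_sub
  have h2 : ∫ t in a..b, deriv f t ≤ 0 := by
    rw [intervalIntegral.integral_of_le hab]
    exact integral_nonpos_of_ae (ae_restrict_of_ae_restrict_of_subset Ioc_subset_Icc_self h)
  linarith

end AbsolutelyContinuous

/-! ### Uniqueness -/

section Uniqueness

variable {n : ℕ} {T : ℝ} {F : ℝ → EuclideanSpace ℝ (Fin n) → Set (EuclideanSpace ℝ (Fin n))}
  {x₀ : EuclideanSpace ℝ (Fin n)}

theorem IsSolution.eqOn (hF : ∀ t ∈ Icc 0 T, IsMonotoneSet (graph (F t)))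
    {x y : ℝ → EuclideanSpace ℝ (Fin n)} (hx : IsSolution T F x₀ x) (hy : IsSolution T F x₀ y) :
    EqOn y x (Icc 0 T) := by
  intro t ht
  have ht0 : uIcc 0 t ⊆ uIcc 0 T := by
    rw [uIcc_of_le ht.1, uIcc_of_le (ht.1.trans ht.2)]
    exact Icc_subset_Icc_right ht.2
  have hd : AbsolutelyContinuousOnInterval (fun s => x s - y s) 0 t :=
    (hx.1.sub hy.1).mono ht0
  obtain ⟨M, hM⟩ := hd.exists_bound
  have hsq : AbsolutelyContinuousOnInterval (fun s => ‖x s - y s‖ ^ 2) 0 t := by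
    refine absolutelyContinuousOnInterval_of_dist_le (K := 2 * M) hd fun r hr s hs => ?_
    have h1 := hM r hr
    have h2 := hM s hs
    have h3 := abs_norm_sub_norm_le (x r - y r) (x s - y s)
    rw [Real.dist_eq, dist_eq_norm, sq_sub_sq, abs_mul]
    refine mul_le_mul ?_ h3 (abs_nonneg _) (by linarith [norm_nonneg (x r - y r)])
    rw [abs_of_nonneg (by positivity)]
    linarith
  have hle := le_of_ae_deriv_nonpos ht.1 hsq (by
    refine ae_restrict_of_ae_restrict_of_subset (Icc_subset_Icc_right ht.2) ?_
    filter_upwards [hx.2.2, hy.2.2, ae_restrict_mem measurableSet_Icc] with s hxs hys hs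
    have h1 := (hxs.2.1.hasDerivAt.sub hys.2.1.hasDerivAt).norm_sq
    have h2 := hF s hs (x s, _) hxs.2.2 (y s, _) hys.2.2
    rw [show (fun s => ‖x s - y s‖ ^ 2) = fun s => ‖(x - y) s‖ ^ 2 from rfl, h1.deriv]
    have h3 : -deriv x s - -deriv y s = -(deriv x s - deriv y s) := by abel
    simp only [h3, inner_neg_right] at h2
    simp only [Pi.sub_apply]
    linarith)
  simp only [hx.2.1, hy.2.1, sub_self, norm_zero] at hle
  have h0 : ‖x t - y t‖ = 0 := by
    have := sq_nonneg ‖x t - y t‖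
    exact pow_eq_zero_iff two_ne_zero |>.1 (le_antisymm (by linarith) this)
  exact (sub_eq_zero.1 (norm_eq_zero.1 h0)).symm

end Uniqueness

/-- A function is somewhere at most its mean. This selects the sampling times, at which a merely
integrable coefficient is controlled. -/
theorem exists_mem_Icc_mul_le_integral {f : ℝ → ℝ} {a b : ℝ} (hab : a < b)
    (hf : IntervalIntegrable f volume a b) :
    ∃ c ∈ Icc a b, (b - a) * f c ≤ ∫ s in a..b, f s := by
  obtain ⟨c, hc, h⟩ := exists_le_setAverage (μ := volume) (s := Ioc a b) (f := f)
    (by simp [hab]) (by simp) hf.1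
  refine ⟨c, Ioc_subset_Icc_self hc, ?_⟩
  rw [setAverage_eq, Real.volume_real_Ioc_of_le hab.le, smul_eq_mul,
    ← intervalIntegral.integral_of_le hab.le] at h
  have hpos : 0 < b - a := sub_pos.2 hab
  calc (b - a) * f c ≤ (b - a) * ((b - a)⁻¹ * ∫ s in a..b, f s) :=
        mul_le_mul_of_nonneg_left h hpos.le
    _ = ∫ s in a..b, f s := by rw [← mul_assoc, mul_inv_cancel₀ hpos.ne', one_mul]

theorem integral_le_integral_of_subinterval {f : ℝ → ℝ} (hf : Integrable f) (h0 : ∀ s, 0 ≤ f s)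
    {a b c d : ℝ} (hca : c ≤ a) (hab : a ≤ b) (hbd : b ≤ d) :
    ∫ s in a..b, f s ≤ ∫ s in c..d, f s :=
  intervalIntegral.integral_mono_interval hca hab hbd (Eventually.of_forall h0)
    hf.intervalIntegrable

/-! ### The proximal scheme and its a priori bounds -/

section Scheme

variable {n : ℕ} {T : ℝ} {F : ℝ → EuclideanSpace ℝ (Fin n) → Set (EuclideanSpace ℝ (Fin n))}

/-- Along a convergent sequence in the domain the minimal sections stay bounded, and outer
semicontinuity at the constant time `t` keeps a subsequential limit in the graph. -/
theorem isClosed_dom (hA1 : ∀ t ∈ Icc 0 T, IsMaximalMonotone (F t))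
    (hA3 : MinimalSectionGrowth T F)
    (hA4 : OuterSemicontinuous T fun t => graph (F t)) {t : ℝ} (ht : t ∈ Icc 0 T) :
    IsClosed (dom (F t)) := by
  refine isClosed_of_closure_subset fun x hx => ?_
  obtain ⟨u, hu, hux⟩ := mem_closure_iff_seq_limit.1 hx
  obtain ⟨r, hr0, hr⟩ := (Metric.isBounded_range_of_tendsto u hux).exists_pos_norm_le
  obtain ⟨σ, -, hσ0, hσ⟩ := hA3 r hr0
  have hb : ∀ l, minimalSection (F t) (u l) ∈ Metric.closedBall 0 (σ t * (1 + r)) := fun l => by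
    rw [mem_closedBall_zero_iff]
    have h1 := hr _ (mem_range_self l)
    refine (hσ t ht (u l) ⟨mem_closedBall_zero_iff.2 h1, hu l⟩).trans ?_
    exact mul_le_mul_of_nonneg_left (by linarith) (hσ0 t ht)
  obtain ⟨v, -, k, hk, hv⟩ := tendsto_subseq_of_bounded Metric.isBounded_closedBall hb
  refine ⟨v, hA4 t ht (show (x, v) ∈ _ from ?_)⟩
  exact ⟨fun _ => t, fun l => (u (k l), minimalSection (F t) (u (k l))),
    fun l => ⟨ht, ((hA1 t ht).minimalSection_spec (hu _)).1⟩, tendsto_const_nhds,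
    (hux.comp hk.tendsto_atTop).prodMk_nhds hv⟩

theorem exists_mem_dom_dist_le {φ : ℝ → ℝ} (hA1 : ∀ t ∈ Icc 0 T, IsMaximalMonotone (F t))
    (hA3 : MinimalSectionGrowth T F) (hA4 : OuterSemicontinuous T fun t => graph (F t))
    (hφ : ∀ s t : ℝ, 0 ≤ s → s ≤ t → t ≤ T →
      ∀ z ∈ dom (F s), Metric.infDist z (dom (F t)) ≤ φ t - φ s)
    {s t : ℝ} (hs : 0 ≤ s) (hst : s ≤ t) (ht : t ≤ T) {z : EuclideanSpace ℝ (Fin n)}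
    (hz : z ∈ dom (F s)) : ∃ p ∈ dom (F t), ‖z - p‖ ≤ φ t - φ s := by
  have ht' : t ∈ Icc 0 T := ⟨hs.trans hst, ht⟩
  obtain ⟨p, hp, h⟩ :=
    (isClosed_dom hA1 hA3 hA4 ht').exists_infDist_eq_dist (hA1 t ht').dom_nonempty z
  exact ⟨p, hp, by rw [← dist_eq_norm, ← h]; exact hφ s t hs hst ht z hz⟩

/-- `N` steps of the proximal scheme with step `h` and sampling times `τ`, with increments
controlled by the density `g`. -/
structure IsProximalScheme
    (F : ℝ → EuclideanSpace ℝ (Fin n) → Set (EuclideanSpace ℝ (Fin n))) (g : ℝ → ℝ) (h : ℝ)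
    (N : ℕ) (X : ℕ → EuclideanSpace ℝ (Fin n)) (τ : ℕ → ℝ) : Prop where
  mem_Icc : ∀ k < N, τ k ∈ Icc (k * h) ((k + 1) * h)
  smul_sub_mem : ∀ k < N, h⁻¹ • (X k - X (k + 1)) ∈ F (τ k) (X (k + 1))
  norm_succ_sub_le : ∀ k < N, ‖X (k + 1) - X k‖ ≤ ∫ s in ((k - 1) * h)..((k + 1) * h), g s

/-- The proximal scheme on a uniform grid, with the sampling times chosen in the cells
so that the increments are controlled by a fixed integrable function. -/
theorem exists_proximal_scheme (hT : 0 < T) (hA1 : ∀ t ∈ Icc 0 T, IsMaximalMonotone (F t))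
    (hA2 : DomainExcessBound T F) (hA3 : MinimalSectionGrowth T F)
    (hA4 : OuterSemicontinuous T fun t => graph (F t))
    {x₀ : EuclideanSpace ℝ (Fin n)} (hx₀ : x₀ ∈ dom (F 0)) :
    ∃ g : ℝ → ℝ, Integrable g ∧ (∀ s, 0 ≤ g s) ∧ ∀ N : ℕ, 0 < N →
      ∃ (X : ℕ → EuclideanSpace ℝ (Fin n)) (τ : ℕ → ℝ), X 0 = x₀ ∧
        IsProximalScheme F g (T / N) N X τ := by
  obtain ⟨φ, hφm, hφac, hφ⟩ := hA2
  set D := φ T - φ 0 with hD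
  have hmono : ∀ s ∈ Icc 0 T, ∀ t ∈ Icc 0 T, s ≤ t → φ s ≤ φ t := fun s hs t ht h => hφm hs ht h
  have h0T : (0 : ℝ) ∈ Icc 0 T := ⟨le_rfl, hT.le⟩
  have hTT : T ∈ Icc 0 T := ⟨hT.le, le_rfl⟩
  have hD0 : 0 ≤ D := sub_nonneg.2 (hmono 0 h0T T hTT hT.le)
  set r := ‖x₀‖ + D + 1 with hr
  have hr0 : 0 < r := by positivity
  obtain ⟨σ₁, hσ₁i, hσ₁0, hσ₁⟩ := hA3 r hr0
  -- `r` bounds the reference sequence `Z`; `R` bounds the nearest points to the iterates in the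
  -- next domain.
  set R := r + 2 * D + (1 + r) * ((∫ s in Icc 0 T, σ₁ s) + 1) with hR
  have hI1 : 0 ≤ ∫ s in Icc 0 T, σ₁ s := setIntegral_nonneg measurableSet_Icc hσ₁0
  have hR0 : 0 < R := by positivity
  obtain ⟨σ₂, hσ₂i, hσ₂0, hσ₂⟩ := hA3 R hR0
  have hI2 : 0 ≤ ∫ s in Icc 0 T, σ₂ s := setIntegral_nonneg measurableSet_Icc hσ₂0
  -- One sampling time must serve both `σ₁` and `σ₂`, while `σ₂` depends on `R`. This weight makes
  -- `ε * ∫ σ₂ ≤ 1`, so the bound on the integral of `q` used in `R` involves `σ₁` only.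
  set ε := ((∫ s in Icc 0 T, σ₂ s) + 1)⁻¹ with hε
  have hε0 : 0 < ε := by positivity
  set q : ℝ → ℝ := (Icc 0 T).indicator fun s => σ₁ s + ε * σ₂ s with hq
  set p : ℝ → ℝ := (Icc 0 T).indicator fun s => |deriv φ s| with hp
  have hqi : Integrable q :=
    (integrable_indicator_iff measurableSet_Icc).2 (hσ₁i.add (hσ₂i.const_mul ε))
  have hφi := hφac.intervalIntegrable_deriv
  have hpi : Integrable p := by
    refine (integrable_indicator_iff measurableSet_Icc).2 ?_
    exact ((intervalIntegrable_iff_integrableOn_Icc_of_le hT.le).1 hφi).abs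
  have hq0 : ∀ s, 0 ≤ q s := fun s => indicator_nonneg (fun s hs =>
    add_nonneg (hσ₁0 s hs) (mul_nonneg hε0.le (hσ₂0 s hs))) s
  have hp0 : ∀ s, 0 ≤ p s := fun s => indicator_nonneg (fun s _ => abs_nonneg _) s
  have hqle : ∀ t, ∫ s in 0..t, q s ≤ (∫ s in Icc 0 T, σ₁ s) + 1 := fun t => by
    have h1 : ∫ s, q s = (∫ s in Icc 0 T, σ₁ s) + ε * ∫ s in Icc 0 T, σ₂ s := by
      rw [hq, integral_indicator measurableSet_Icc, integral_add hσ₁i (hσ₂i.const_mul ε),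
        integral_const_mul]
    have h2 : ε * ∫ s in Icc 0 T, σ₂ s ≤ 1 := by
      rw [hε, inv_mul_le_iff₀ (by positivity)]
      linarith
    have h3 : ∫ s in 0..t, q s ≤ ∫ s, q s := by
      rcases le_total 0 t with h | h
      · rw [intervalIntegral.integral_of_le h]
        exact setIntegral_le_integral hqi (Eventually.of_forall hq0)
      · rw [intervalIntegral.integral_of_ge h]
        have h4 := setIntegral_nonneg (μ := volume) (s := Ioc t 0) measurableSet_Ioc
          fun s _ => hq0 s
        have h5 : 0 ≤ ∫ s, q s := integral_nonneg hq0
        linarith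
    linarith
  have hpφ : ∀ s t, 0 ≤ s → s ≤ t → t ≤ T → φ t - φ s ≤ ∫ r in s..t, p r := by
    intro s t hs hst ht
    have hsub : uIcc s t ⊆ uIcc 0 T := by
      rw [uIcc_of_le hst, uIcc_of_le hT.le]
      exact Icc_subset_Icc hs ht
    rw [← (hφac.mono hsub).integral_deriv_eq_sub]
    refine intervalIntegral.integral_mono_on hst (hφi.mono_set hsub) hpi.intervalIntegrable ?_
    intro r hr
    rw [hp, indicator_of_mem (show r ∈ Icc 0 T from ⟨hs.trans hr.1, hr.2.trans ht⟩)]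
    exact le_abs_self _
  -- The domain displacement counts twice: going from `X k` to the comparison point `w`, and again
  -- in the resolvent estimate from `w` to `X (k + 1)`.
  refine ⟨fun s => 2 * p s + ε⁻¹ * (1 + R) * q s,
    (hpi.const_mul 2).add (hqi.const_mul _), fun s => by
      have := hp0 s; have := hq0 s; positivity, fun N hN => ?_⟩
  have hN' : (0 : ℝ) < N := Nat.cast_pos.2 hN
  set h := T / N with hh
  have hh0 : 0 < h := div_pos hT hN'
  have hNh : N * h = T := by rw [hh]; field_simp
  have hcell : ∀ k : ℕ, ∃ c ∈ Icc (k * h) ((k + 1) * h),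
      h * q c ≤ ∫ s in (k * h)..((k + 1) * h), q s := fun k => by
    obtain ⟨c, hc, h1⟩ := exists_mem_Icc_mul_le_integral (a := k * h) (b := (k + 1) * h)
      (by linarith) hqi.intervalIntegrable
    exact ⟨c, hc, by rwa [show (k + 1) * h - k * h = h by ring] at h1⟩
  choose τ hτ hτq using hcell
  have hkT : ∀ k < N, (k + 1) * h ≤ T := fun k hk => by
    rw [← hNh]
    exact mul_le_mul_of_nonneg_right (by exact_mod_cast hk) hh0.le
  have hτT : ∀ k < N, τ k ∈ Icc 0 T := fun k hk =>
    ⟨le_trans (by positivity) (hτ k).1, (hτ k).2.trans (hkT k hk)⟩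
  -- `s k` is the previous sampling time, so that `X k` lies in the domain at `s k`. The passage
  -- from `s k` to `τ k` may span two cells, hence the double cells in the increment bound.
  let s : ℕ → ℝ := fun k => Nat.casesOn k 0 τ
  have hs0 : s 0 = 0 := rfl
  have hs1 : ∀ k, s (k + 1) = τ k := fun k => rfl
  have hsT : ∀ k ≤ N, s k ∈ Icc 0 T := by
    rintro (_ | k) hk
    · exact h0T
    · exact hτT k hk
  have hsl : ∀ k, (k - 1) * h ≤ s k ∧ s k ≤ k * h := by
    rintro (_ | k)
    · simp [hs0, hh0.le]
    · rw [hs1]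
      push_cast
      rw [add_sub_cancel_right]
      exact hτ k
  have hsτ : ∀ k, s k ≤ τ k := fun k => (hsl k).2.trans (hτ k).1
  have hqadd : ∀ k : ℕ, ∫ s in 0..((k + 1 : ℕ) * h), q s
      = (∫ s in 0..(k * h), q s) + ∫ s in (k * h)..((k + 1) * h), q s := fun k => by
    push_cast
    rw [intervalIntegral.integral_add_adjacent_intervals] <;> exact hqi.intervalIntegrable
  have hJ : ∀ (k : ℕ) (z : EuclideanSpace ℝ (Fin n)), ∃ x, k < N → h⁻¹ • (z - x) ∈ F (τ k) x := by
    intro k z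
    by_cases hk : k < N
    · obtain ⟨x, hx⟩ := (hA1 _ (hτT k hk)).exists_resolvent hh0 z
      exact ⟨x, fun _ => hx⟩
    · exact ⟨z, fun h => absurd h hk⟩
  choose J hJ using hJ
  have hP : ∀ (k : ℕ) (z : EuclideanSpace ℝ (Fin n)), ∃ x, k < N → z ∈ dom (F (s k)) →
      x ∈ dom (F (τ k)) ∧ ‖z - x‖ ≤ φ (τ k) - φ (s k) := by
    intro k z
    by_cases hk : k < N ∧ z ∈ dom (F (s k))
    · obtain ⟨x, hx, hx'⟩ := exists_mem_dom_dist_le hA1 hA3 hA4 hφ (hsT k hk.1.le).1 (hsτ k)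
        (hτT k hk.1).2 hk.2
      exact ⟨x, fun _ _ => ⟨hx, hx'⟩⟩
    · exact ⟨z, fun h h' => absurd ⟨h, h'⟩ hk⟩
  choose P hP using hP
  let X : ℕ → EuclideanSpace ℝ (Fin n) := fun k => Nat.rec x₀ J k
  -- Successive nearest points in the moving domains: bounded by the variation of `φ` alone, hence
  -- an admissible comparison for `X` before any bound on `X` is known.
  let Z : ℕ → EuclideanSpace ℝ (Fin n) := fun k => Nat.rec x₀ P k
  have hX1 : ∀ k < N, h⁻¹ • (X k - X (k + 1)) ∈ F (τ k) (X (k + 1)) := fun k hk => hJ k (X k) hk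
  have hXd : ∀ k ≤ N, X k ∈ dom (F (s k)) := by
    rintro (_ | k) hk
    · exact hx₀
    · exact ⟨_, hX1 k hk⟩
  have hZd : ∀ k ≤ N, Z k ∈ dom (F (s k)) := by
    intro k
    induction k with
    | zero => exact fun _ => hx₀
    | succ k ih => exact fun hk => (hP k (Z k) hk (ih (Nat.le_of_succ_le hk))).1
  have hZ1 : ∀ k < N, ‖Z k - Z (k + 1)‖ ≤ φ (τ k) - φ (s k) := fun k hk =>
    (hP k (Z k) hk (hZd k hk.le)).2
  have hφD : ∀ k ≤ N, φ (s k) - φ 0 ≤ D := fun k hk =>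
    sub_le_sub_right (hmono _ (hsT k hk) T hTT (hsT k hk).2) _
  have hZb : ∀ k ≤ N, ‖Z k‖ ≤ ‖x₀‖ + (φ (s k) - φ 0) := by
    intro k
    induction k with
    | zero => intro _; rw [hs0, sub_self, add_zero]; exact le_rfl
    | succ k ih =>
      intro hk
      have h1 := ih (Nat.le_of_succ_le hk)
      have h2 := hZ1 k hk
      have h3 := norm_sub_norm_le (Z (k + 1)) (Z k)
      rw [norm_sub_rev] at h3
      rw [hs1]
      linarith
  have hstep : ∀ k < N, ∀ w ∈ dom (F (τ k)), ∀ σ : ℝ → ℝ,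
      ‖minimalSection (F (τ k)) w‖ ≤ σ (τ k) →
      ‖X (k + 1) - w‖ ≤ ‖X k - w‖ + h * σ (τ k) := fun k hk w hw σ hσ =>
    ((hA1 _ (hτT k hk)).norm_resolvent_sub_le hh0 (hX1 k hk)
      ((hA1 _ (hτT k hk)).minimalSection_spec hw).1).trans
      (by gcongr)
  have hqτ : ∀ k < N, q (τ k) = σ₁ (τ k) + ε * σ₂ (τ k) := fun k hk =>
    indicator_of_mem (hτT k hk) _
  have hXZ : ∀ k ≤ N, ‖X k - Z k‖ ≤ (φ (s k) - φ 0) + (1 + r) * ∫ s in 0..(k * h), q s := by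
    intro k
    induction k with
    | zero => intro _; simp [X, Z, hs0]
    | succ k ih =>
      intro hk
      have h1 := ih (Nat.le_of_succ_le hk)
      have hZr : ‖Z (k + 1)‖ ≤ r := by
        have h2 := hZb _ hk
        have h3 := hφD _ hk
        linarith
      have h4 := hstep k hk _ (hZd _ hk) (fun t => σ₁ t * (1 + r))
        ((hσ₁ _ (hτT k hk) _ ⟨mem_closedBall_zero_iff.2 hZr, hZd _ hk⟩).trans
          (mul_le_mul_of_nonneg_left (by linarith) (hσ₁0 _ (hτT k hk))))
      have h5 := norm_sub_le_norm_sub_add_norm_sub (X k) (Z k) (Z (k + 1))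
      have h6 := hZ1 k hk
      have h7 : h * σ₁ (τ k) ≤ ∫ s in (k * h)..((k + 1) * h), q s := by
        refine le_trans ?_ (hτq k)
        rw [hqτ k hk]
        exact mul_le_mul_of_nonneg_left
          (le_add_of_nonneg_right (mul_nonneg hε0.le (hσ₂0 _ (hτT k hk)))) hh0.le
      have h8 := mul_le_mul_of_nonneg_left h7 (show 0 ≤ 1 + r by linarith)
      rw [hqadd k, hs1]
      linarith
  refine ⟨X, τ, rfl, fun k _ => hτ k, hX1, fun k hk => ?_⟩
  obtain ⟨w, hw, hwX⟩ := exists_mem_dom_dist_le hA1 hA3 hA4 hφ (hsT k hk.le).1 (hsτ k)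
    (hτT k hk).2 (hXd k hk.le)
  have hwR : ‖w‖ ≤ R := by
    have h1 := hZb k hk.le
    have h2 := hXZ k hk.le
    have h3 := hφD k hk.le
    have h4 := mul_le_mul_of_nonneg_left (hqle (k * h)) (show 0 ≤ 1 + r by linarith)
    have h5 := norm_sub_norm_le w (X k)
    rw [norm_sub_rev] at h5
    have h6 := norm_sub_norm_le (X k) (Z k)
    have h7 := hφD (k + 1) hk
    rw [hs1] at h7
    linarith
  have h1 := hstep k hk w hw (fun t => σ₂ t * (1 + R))
    ((hσ₂ _ (hτT k hk) _ ⟨mem_closedBall_zero_iff.2 hwR, hw⟩).trans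
      (mul_le_mul_of_nonneg_left (by linarith) (hσ₂0 _ (hτT k hk))))
  have h2 : h * σ₂ (τ k) ≤ ε⁻¹ * ∫ s in (k * h)..((k + 1) * h), q s := by
    rw [le_inv_mul_iff₀ hε0]
    refine le_trans ?_ (hτq k)
    rw [hqτ k hk]
    have := mul_nonneg hh0.le (hσ₁0 _ (hτT k hk))
    linarith
  have h3 : ∫ s in (k * h)..((k + 1) * h), q s ≤ ∫ s in ((k - 1) * h)..((k + 1) * h), q s :=
    integral_le_integral_of_subinterval hqi hq0 (by linarith) (by linarith) le_rfl
  have h4 : φ (τ k) - φ (s k) ≤ ∫ s in ((k - 1) * h)..((k + 1) * h), p s :=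
    (hpφ _ _ (hsT k hk.le).1 (hsτ k) (hτT k hk).2).trans
      (integral_le_integral_of_subinterval hpi hp0 (hsl k).1 (hsτ k) (hτ k).2)
  have h5 := norm_sub_le_norm_sub_add_norm_sub (X (k + 1)) w (X k)
  rw [norm_sub_rev w] at h5
  have h6 := mul_le_mul_of_nonneg_left
    (h2.trans (mul_le_mul_of_nonneg_left h3 (inv_pos.2 hε0).le)) (show 0 ≤ 1 + R by linarith)
  rw [intervalIntegral.integral_add (hpi.const_mul 2).intervalIntegrable
    (hqi.const_mul _).intervalIntegrable, intervalIntegral.integral_const_mul,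
    intervalIntegral.integral_const_mul]
  linarith

end Scheme

/-! ### Primitives and truncated densities -/

section Integrals

theorem continuous_primitive_zero {f : ℝ → ℝ} (hf : Integrable f) :
    Continuous fun t => ∫ s in 0..t, f s :=
  intervalIntegral.continuous_primitive (fun _ _ => hf.intervalIntegrable) 0

theorem integral_eq_sub_primitive {f : ℝ → ℝ} (hf : Integrable f) (a b : ℝ) :
    ∫ s in a..b, f s = (∫ s in 0..b, f s) - ∫ s in 0..a, f s :=
  (intervalIntegral.integral_interval_sub_left hf.intervalIntegrable hf.intervalIntegrable).symm

theorem tendsto_integral_widened {f : ℝ → ℝ} (hf : Integrable f) {ι : Type*} {l : Filter ι}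
    {h : ι → ℝ} (hh : Tendsto h l (𝓝 0)) (a b : ℝ) :
    Tendsto (fun i => ∫ s in (a - h i)..(b + h i), f s) l (𝓝 (∫ s in a..b, f s)) := by
  have hc := continuous_primitive_zero hf
  have h1 : Tendsto (fun i => b + h i) l (𝓝 b) := by simpa using hh.const_add b
  have h2 : Tendsto (fun i => a - h i) l (𝓝 a) := by simpa using hh.const_sub a
  rw [integral_eq_sub_primitive hf a b]
  simp only [fun i => integral_eq_sub_primitive hf (a - h i) (b + h i)]
  exact ((hc.tendsto b).comp h1).sub ((hc.tendsto a).comp h2)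

theorem integrable_posPart_sub {g : ℝ → ℝ} (hg : Integrable g) (hg0 : ∀ s, 0 ≤ g s) {C : ℝ}
    (hC : 0 ≤ C) : Integrable fun s => max (g s - C) 0 := by
  refine hg.mono' ((hg.aestronglyMeasurable.sub aestronglyMeasurable_const).sup
    aestronglyMeasurable_const) (Eventually.of_forall fun s => ?_)
  rw [Real.norm_of_nonneg (le_max_right _ _)]
  exact max_le (by linarith) (hg0 s)

theorem integral_le_integral_posPart_add {g : ℝ → ℝ} (hg : Integrable g) (hg0 : ∀ s, 0 ≤ g s)
    {C : ℝ} (hC : 0 ≤ C) {a b : ℝ} (hab : a ≤ b) :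
    ∫ s in a..b, g s ≤ (∫ s in a..b, max (g s - C) 0) + C * (b - a) := by
  have hi := (integrable_posPart_sub hg hg0 hC).intervalIntegrable (a := a) (b := b)
  have h1 : ∫ s in a..b, g s ≤ ∫ s in a..b, (max (g s - C) 0 + C) :=
    intervalIntegral.integral_mono_on hab hg.intervalIntegrable
      (hi.add intervalIntegrable_const) fun s _ => by
        linarith [le_max_left (g s - C) 0]
  rwa [intervalIntegral.integral_add hi intervalIntegrable_const,
    intervalIntegral.integral_const, smul_eq_mul, mul_comm] at h1

end Integrals

/-! ### Summed estimates for the scheme -/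

section Scheme

variable {n N : ℕ} {T h : ℝ}
  {F : ℝ → EuclideanSpace ℝ (Fin n) → Set (EuclideanSpace ℝ (Fin n))} {g : ℝ → ℝ}
  {X : ℕ → EuclideanSpace ℝ (Fin n)} {τ : ℕ → ℝ}

/-- Consecutive double cells cover every cell at most twice. -/
theorem le_two_mul_integral_of_le_double_cell {f : ℝ → ℝ} (hf : Integrable f)
    (hf0 : ∀ s, 0 ≤ f s) (hh : 0 ≤ h) {a : ℕ → ℝ} {j k : ℕ} (hjk : j ≤ k) (haj : a j = 0)
    (ha : ∀ i, j ≤ i → i < k → a (i + 1) ≤ a i + ∫ s in ((i - 1) * h)..((i + 1) * h), f s) :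
    a k ≤ 2 * ∫ s in ((j - 1) * h)..(k * h), f s := by
  -- Each double cell splits into a left and a right cell, and the two families telescope
  -- separately.
  have key : ∀ i, j ≤ i → i ≤ k →
      a i ≤ (∫ s in ((j - 1) * h)..((i - 1) * h), f s) + ∫ s in (j * h)..(i * h), f s := by
    intro i hji
    induction i, hji using Nat.le_induction with
    | base => simp [haj]
    | succ i hji ih =>
      intro hik
      have h1 := ih (Nat.le_of_succ_le hik)
      have h2 := ha i hji hik
      push_cast
      rw [add_sub_cancel_right]
      rw [integral_eq_sub_primitive hf (_ * h), integral_eq_sub_primitive hf (_ * h)] at h1 ⊢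
      rw [integral_eq_sub_primitive hf] at h2
      linarith
  have h1 := key k hjk le_rfl
  have hjk' : (j : ℝ) ≤ k := Nat.cast_le.2 hjk
  have h2 : ∫ s in ((j - 1) * h)..((k - 1) * h), f s ≤ ∫ s in ((j - 1) * h)..(k * h), f s :=
    integral_le_integral_of_subinterval hf hf0 le_rfl (by gcongr) (by linarith)
  have h3 : ∫ s in (j * h)..(k * h), f s ≤ ∫ s in ((j - 1) * h)..(k * h), f s :=
    integral_le_integral_of_subinterval hf hf0 (by linarith) (by gcongr) le_rfl
  linarith

theorem IsProximalScheme.norm_sub_le_two_mul (hX : IsProximalScheme F g h N X τ)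
    (hg : Integrable g) (hg0 : ∀ s, 0 ≤ g s) (hh : 0 ≤ h) {j k : ℕ} (hjk : j ≤ k) (hk : k ≤ N) :
    ‖X k - X j‖ ≤ 2 * ∫ s in ((j - 1) * h)..(k * h), g s :=
  le_two_mul_integral_of_le_double_cell (a := fun i => ‖X i - X j‖) hg hg0 hh hjk (by simp)
    fun i _ hi => by
      have h1 := norm_sub_le_norm_sub_add_norm_sub (X (i + 1)) (X i) (X j)
      have h2 := hX.norm_succ_sub_le i (hi.trans_le hk)
      linarith

/-- Steps with large velocity contribute little to the discrete monotonicity inequality. -/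
theorem IsProximalScheme.le_inner_sub (hX : IsProximalScheme F g h N X τ)
    (hg : Integrable g) (hg0 : ∀ s, 0 ≤ g s) (hh : 0 < h) {j k : ℕ} (hjk : j ≤ k) (hk : k ≤ N)
    {a v : EuclideanSpace ℝ (Fin n)} {C ε : ℝ} (hC : ‖v‖ ≤ C) (hε : 0 ≤ ε)
    (H : ∀ i, j ≤ i → i < k → ‖h⁻¹ • (X i - X (i + 1))‖ ≤ 4 * C →
      -ε ≤ inner ℝ a (h⁻¹ • (X i - X (i + 1)) - v)) :
    -(ε * (k * h - j * h)) - 8 * ‖a‖ * ∫ s in ((j - 1) * h)..(k * h), max (g s - C) 0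
      ≤ inner ℝ a (X j - X k - (k * h - j * h) • v) := by
  have hC0 : 0 ≤ C := (norm_nonneg v).trans hC
  have hgC := integrable_posPart_sub hg hg0 hC0
  have hgC0 : ∀ s, 0 ≤ max (g s - C) 0 := fun s => le_max_right _ _
  have ha := norm_nonneg a
  have key := le_two_mul_integral_of_le_double_cell
    (f := fun s => 4 * ‖a‖ * max (g s - C) 0) (h := h)
    (a := fun i => -(ε * (i * h - j * h)) - inner ℝ a (X j - X i - (i * h - j * h) • v))
    (hgC.const_mul _) (fun s => mul_nonneg (by positivity) (hgC0 s)) hh.le hjk (by simp)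
    fun i hji hik => by
      set V := h⁻¹ • (X i - X (i + 1)) with hV
      set P := ∫ s in ((i - 1) * h)..((i + 1) * h), max (g s - C) 0 with hP
      have hP0 : 0 ≤ P := intervalIntegral.integral_nonneg (by nlinarith) fun s _ => hgC0 s
      have hhV : h • V = X i - X (i + 1) := by
        rw [hV, smul_smul, mul_inv_cancel₀ hh.ne', one_smul]
      have hcell : -(ε * h) - 4 * ‖a‖ * P ≤ h * inner ℝ a (V - v) := by
        -- If `‖V‖ > 4 * C`, then `h * ‖V‖ ≤ P + 2 * C * h` and the last term is at most half the
        -- left side, so `h * ‖V‖ ≤ 2 * P`. With `‖V - v‖ ≤ 2 * ‖V‖` this costs `4 * ‖a‖ * P`;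
        -- overlapping double cells turn 4 into 8.
        rcases le_or_gt ‖V‖ (4 * C) with hVC | hVC
        · have h1 := mul_le_mul_of_nonneg_left (H i hji hik hVC) hh.le
          have h2 : 0 ≤ 4 * ‖a‖ * P := by positivity
          linarith
        · have h1 := hX.norm_succ_sub_le i (hik.trans_le hk)
          rw [norm_sub_rev, ← hhV, norm_smul, Real.norm_of_nonneg hh.le] at h1
          have h2 := integral_le_integral_posPart_add hg hg0 hC0
            (show ((i : ℝ) - 1) * h ≤ (i + 1) * h by nlinarith)
          have h3 : C * (((i : ℝ) + 1) * h - (i - 1) * h) = 2 * (C * h) := by ring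
          rw [h3] at h2
          have h4 : h * (4 * C) ≤ h * ‖V‖ := mul_le_mul_of_nonneg_left hVC.le hh.le
          have h5 : h * ‖V‖ ≤ 2 * P := by linarith
          have h6 := neg_le_of_abs_le (abs_real_inner_le_norm a (V - v))
          have h7 : ‖V - v‖ ≤ 2 * ‖V‖ := (norm_sub_le _ _).trans (by linarith)
          have h8 := mul_le_mul_of_nonneg_left h7 ha
          have h9 := mul_le_mul_of_nonneg_left h5 ha
          have h10 := mul_le_mul_of_nonneg_left (h6.trans' (neg_le_neg h8)) hh.le
          have h11 : 0 ≤ ε * h := by positivity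
          linarith
      have h12 : X j - X (i + 1) - (((i + 1 : ℕ) : ℝ) * h - j * h) • v
          = (X j - X i - (i * h - j * h) • v) + h • (V - v) := by
        rw [smul_sub, hhV]
        push_cast
        module
      rw [h12, inner_add_right, inner_smul_right, intervalIntegral.integral_const_mul, ← hP]
      push_cast
      linarith
  rw [intervalIntegral.integral_const_mul] at key
  linarith

end Scheme

/-! ### Passage to the limit in the inclusion -/

section Limit

variable {n : ℕ} {T : ℝ} {F : ℝ → EuclideanSpace ℝ (Fin n) → Set (EuclideanSpace ℝ (Fin n))}

/-- Otherwise bounded values `w` at nearby graph points violate the inequality; a subsequential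
limit lies in `F t y` and contradicts monotonicity of `F t`. -/
theorem OuterSemicontinuous.exists_pos_forall_le_inner
    (hA4 : OuterSemicontinuous T fun t => graph (F t)) {t : ℝ} (ht : t ∈ Icc 0 T)
    (hF : IsMonotoneSet (graph (F t))) {u v : EuclideanSpace ℝ (Fin n)} (hv : v ∈ F t u)
    (y : EuclideanSpace ℝ (Fin n)) (M : ℝ) {ε : ℝ} (hε : 0 < ε) :
    ∃ η > 0, ∀ s ∈ Icc 0 T, ∀ z, ∀ w ∈ F s z, |s - t| < η → ‖z - y‖ < η → ‖w‖ ≤ M →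
      -ε ≤ inner ℝ (y - u) (w - v) := by
  by_contra! hcon
  choose s hs z w hw hst hzy hwM hlt using fun l : ℕ =>
    hcon (1 / ((l : ℝ) + 1)) Nat.one_div_pos_of_nat
  have hb : ∀ l, w l ∈ Metric.closedBall 0 M := fun l => mem_closedBall_zero_iff.2 (hwM l)
  obtain ⟨w', -, k, hk, hw'⟩ := tendsto_subseq_of_bounded Metric.isBounded_closedBall hb
  have h0 := (tendsto_one_div_add_atTop_nhds_zero_nat (𝕜 := ℝ))
  have hs' : Tendsto s atTop (𝓝 t) := by
    rw [tendsto_iff_dist_tendsto_zero]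
    exact squeeze_zero (fun _ => dist_nonneg) (fun l => (hst l).le) h0
  have hz' : Tendsto z atTop (𝓝 y) := by
    rw [tendsto_iff_norm_sub_tendsto_zero]
    exact squeeze_zero (fun _ => norm_nonneg _) (fun l => (hzy l).le) h0
  have hmem : (y, w') ∈ graph (F t) := hA4 t ht ⟨fun l => s (k l), fun l => (z (k l), w (k l)),
    fun l => ⟨hs _, hw _⟩, hs'.comp hk.tendsto_atTop,
    (hz'.comp hk.tendsto_atTop).prodMk_nhds hw'⟩
  have h1 := hF (y, w') hmem (u, v) hv
  have h2 : Tendsto (fun l => inner ℝ (y - u) (w (k l) - v)) atTop (𝓝 (inner ℝ (y - u) (w' - v))) :=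
    tendsto_const_nhds.inner (hw'.sub_const v)
  have h3 := le_of_tendsto h2 (Eventually.of_forall fun l => (hlt (k l)).le)
  simp only at h1
  linarith

/-- A limit along a filter of proximal schemes satisfies the inclusion at every time that
is a differentiability point of the limit and of the truncated integrals of the density. -/
theorem neg_deriv_mem_of_tendsto (hA1 : ∀ t ∈ Icc 0 T, IsMaximalMonotone (F t))
    (hA4 : OuterSemicontinuous T fun t => graph (F t)) {g : ℝ → ℝ} (hg : Integrable g)
    (hg0 : ∀ s, 0 ≤ g s) {l : Filter ℕ} [l.NeBot] {h : ℕ → ℝ} (hh : ∀ N, 0 < h N)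
    (hhT : ∀ N, (N + 1 : ℕ) * h N = T) (hh0 : Tendsto h l (𝓝 0))
    {X : ℕ → ℕ → EuclideanSpace ℝ (Fin n)} {τ : ℕ → ℕ → ℝ}
    (hX : ∀ N, IsProximalScheme F g (h N) (N + 1) (X N) (τ N))
    {x : ℝ → EuclideanSpace ℝ (Fin n)}
    (hx : ∀ t ∈ Icc 0 T, Tendsto (fun N => X N ⌈t / h N⌉₊) l (𝓝 (x t)))
    {t : ℝ} (ht : t ∈ Ioo 0 T) {x' : EuclideanSpace ℝ (Fin n)} (hx' : HasDerivAt x x' t)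
    (hgt : ∀ C : ℕ, HasDerivAt (fun r => ∫ s in 0..r, max (g s - C) 0) (max (g t - C) 0) t) :
    -x' ∈ F t (x t) := by
  have htI : t ∈ Icc 0 T := Ioo_subset_Icc_self ht
  refine (hA1 t htI).mem_of_forall fun u v hv => ?_
  set a := x t - u with ha
  -- Since `C ≥ g t`, the truncated density vanishes at `t` and its primitive has derivative zero
  -- there. Integer levels keep the exceptional null sets countable in number.
  obtain ⟨C, hC⟩ := exists_nat_ge (max (g t) ‖v‖)
  have hgC : max (g t - C) 0 = 0 := max_eq_right (by linarith [le_max_left (g t) ‖v‖])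
  have hvC : ‖v‖ ≤ C := (le_max_right _ _).trans hC
  have hgCi := integrable_posPart_sub hg hg0 (C.cast_nonneg (α := ℝ))
  refine le_of_forall_pos_le_add fun ε hε => ?_
  obtain ⟨η, hη, hosc⟩ := hA4.exists_pos_forall_le_inner htI (hA1 t htI).1 hv (x t) (4 * C) hε
  have hceil : ∀ s, 0 ≤ s → ∀ N, s ≤ ⌈s / h N⌉₊ * h N ∧ ⌈s / h N⌉₊ * h N ≤ s + h N := by
    intro s hs N
    have h1 := Nat.le_ceil (s / h N)
    have h2 := (Nat.ceil_lt_add_one (div_nonneg hs (hh N).le)).le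
    rw [div_le_iff₀ (hh N)] at h1
    have h3 := mul_le_mul_of_nonneg_right h2 (hh N).le
    rw [add_mul, div_mul_cancel₀ _ (hh N).ne', one_mul] at h3
    exact ⟨h1, h3⟩
  have hceilT : ∀ s, 0 ≤ s → Tendsto (fun N => ⌈s / h N⌉₊ * h N) l (𝓝 s) := fun s hs =>
    tendsto_of_tendsto_of_tendsto_of_le_of_le tendsto_const_nhds
      (by simpa using hh0.const_add s) (fun N => (hceil s hs N).1) fun N => (hceil s hs N).2
  -- The smallness conditions on `δ` eventually keep all sampling times and iterates of the window
  -- within `η` of `t` and `x t`.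
  have hmain : ∀ δ, 0 < δ → t + δ ≤ T → δ < η / 2 → 2 * ∫ s in t..(t + δ), g s < η / 2 →
      -(ε * δ) - 8 * ‖a‖ * ∫ s in t..(t + δ), max (g s - C) 0
        ≤ inner ℝ a (x t - x (t + δ) - δ • v) := by
    intro δ hδ hδT hδη hgη
    have htδ : t + δ ∈ Icc 0 T := ⟨by linarith [ht.1], hδT⟩
    have hlim : Tendsto (fun N => inner ℝ a (X N ⌈t / h N⌉₊ - X N ⌈(t + δ) / h N⌉₊ -
        (⌈(t + δ) / h N⌉₊ * h N - ⌈t / h N⌉₊ * h N) • v)) l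
        (𝓝 (inner ℝ a (x t - x (t + δ) - (t + δ - t) • v))) :=
      tendsto_const_nhds.inner (((hx t htI).sub (hx _ htδ)).sub
        (((hceilT _ htδ.1).sub (hceilT t htI.1)).smul_const v))
    have hlim' : Tendsto (fun N => -(ε * (⌈(t + δ) / h N⌉₊ * h N - ⌈t / h N⌉₊ * h N)) -
        8 * ‖a‖ * ∫ s in (t - h N)..(t + δ + h N), max (g s - C) 0) l
        (𝓝 (-(ε * (t + δ - t)) - 8 * ‖a‖ * ∫ s in t..(t + δ), max (g s - C) 0)) :=
      (((hceilT _ htδ.1).sub (hceilT t htI.1)).const_mul ε).neg.sub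
        ((tendsto_integral_widened hgCi hh0 t (t + δ)).const_mul _)
    rw [add_sub_cancel_left] at hlim hlim'
    refine le_of_tendsto_of_tendsto hlim' hlim ?_
    filter_upwards [hh0.eventually (gt_mem_nhds (half_pos hη)),
      ((tendsto_integral_widened hg hh0 t (t + δ)).const_mul 2).eventually (gt_mem_nhds hgη),
      (tendsto_iff_norm_sub_tendsto_zero.1 (hx t htI)).eventually (gt_mem_nhds (half_pos hη))]
      with N hN1 hN2 hN3
    set j := ⌈t / h N⌉₊ with hj
    set k := ⌈(t + δ) / h N⌉₊ with hk
    have hNpos := hh N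
    have hjk : j ≤ k := Nat.ceil_mono (div_le_div_of_nonneg_right (by linarith) hNpos.le)
    have hkN : k ≤ N + 1 := by
      refine Nat.ceil_le.2 ?_
      rw [div_le_iff₀ hNpos, hhT]
      exact hδT
    obtain ⟨hj1, hj2⟩ := hceil t htI.1 N
    obtain ⟨hk1, hk2⟩ := hceil _ htδ.1 N
    rw [← hj] at hj1 hj2
    rw [← hk] at hk1 hk2
    refine le_trans ?_ ((hX N).le_inner_sub hg hg0 hNpos hjk hkN hvC hε.le
      fun i hji hik hV => ?_)
    · have hjk' : (j : ℝ) ≤ k := Nat.cast_le.2 hjk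
      have h1 : ∫ s in ((j - 1) * h N)..(k * h N), max (g s - C) 0
          ≤ ∫ s in (t - h N)..(t + δ + h N), max (g s - C) 0 :=
        integral_le_integral_of_subinterval hgCi (fun s => le_max_right _ _) (by linarith)
          (mul_le_mul_of_nonneg_right (by linarith) hNpos.le) hk2
      have h2 := mul_le_mul_of_nonneg_left h1 (show 0 ≤ 8 * ‖a‖ by positivity)
      linarith
    · have hiN : i < N + 1 := hik.trans_le hkN
      have hτ := (hX N).mem_Icc i hiN
      have hji' : (j : ℝ) * h N ≤ i * h N :=
        mul_le_mul_of_nonneg_right (Nat.cast_le.2 hji) hNpos.le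
      have hik' : ((i : ℝ) + 1) * h N ≤ k * h N :=
        mul_le_mul_of_nonneg_right (by exact_mod_cast hik) hNpos.le
      have hiT : ((i : ℝ) + 1) * h N ≤ T := by
        rw [← hhT N]
        exact mul_le_mul_of_nonneg_right (by exact_mod_cast hiN) hNpos.le
      refine hosc (τ N i) ⟨by linarith [hτ.1, ht.1], hτ.2.trans hiT⟩ _ _
        ((hX N).smul_sub_mem i hiN) ?_ ?_ hV
      · rw [abs_of_nonneg (by linarith [hτ.1])]
        linarith [hτ.2]
      · have h1 := (hX N).norm_sub_le_two_mul hg hg0 hNpos.le (hji.trans (Nat.le_succ i)) hiN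
        have h2 : ∫ s in ((j - 1) * h N)..((i + 1 : ℕ) * h N), g s
            ≤ ∫ s in (t - h N)..(t + δ + h N), g s :=
          integral_le_integral_of_subinterval hg hg0 (by linarith)
            (by push_cast; linarith) (by push_cast; linarith)
        have h3 := norm_sub_le_norm_sub_add_norm_sub (X N (i + 1)) (X N j) (x t)
        linarith
  -- Divide `hmain` by `δ` and let `δ` decrease to zero; the truncation error disappears and `ε` is
  -- arbitrary.
  have hslope : Tendsto (fun δ : ℝ => inner ℝ a (-(δ⁻¹ • (x (t + δ) - x t)) - v)) (𝓝[>] 0)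
      (𝓝 (inner ℝ a (-x' - v))) :=
    tendsto_const_nhds.inner (hx'.tendsto_slope_zero_right.neg.sub_const v)
  have hslope' : Tendsto (fun δ : ℝ => -ε - 8 * ‖a‖ * (δ⁻¹ •
      ((∫ s in 0..(t + δ), max (g s - C) 0) - ∫ s in 0..t, max (g s - C) 0))) (𝓝[>] 0)
      (𝓝 (-ε - 8 * ‖a‖ * 0)) := by
    have h1 := (hgt C).tendsto_slope_zero_right
    rw [hgC] at h1
    exact (h1.const_mul (8 * ‖a‖)).const_sub (-ε)
  have hsmall : Tendsto (fun δ : ℝ => 2 * ∫ s in t..(t + δ), g s) (𝓝[>] 0) (𝓝 0) := by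
    have h1 : Continuous fun δ : ℝ => 2 * ∫ s in t..(t + δ), g s := by
      simp only [fun δ => integral_eq_sub_primitive hg t (t + δ)]
      have := continuous_primitive_zero hg
      fun_prop
    have h2 := h1.tendsto 0
    simp only [add_zero, intervalIntegral.integral_same, mul_zero] at h2
    exact h2.mono_left nhdsWithin_le_nhds
  have hfin : -ε - 8 * ‖a‖ * 0 ≤ inner ℝ a (-x' - v) := by
    refine le_of_tendsto_of_tendsto hslope' hslope ?_
    filter_upwards [self_mem_nhdsWithin,
      nhdsWithin_le_nhds (gt_mem_nhds (lt_min (sub_pos.2 ht.2) (half_pos hη))),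
      hsmall.eventually (gt_mem_nhds (half_pos hη))] with δ hδ hδ2 hδ3
    have hδ0 : 0 < δ := hδ
    have h1 := hmain δ hδ0 (by linarith [lt_min_iff.1 hδ2]) (lt_min_iff.1 hδ2).2 hδ3
    have h2 := mul_le_mul_of_nonneg_left h1 (inv_pos.2 hδ0).le
    have h3 : -(δ⁻¹ • (x (t + δ) - x t)) - v = δ⁻¹ • (x t - x (t + δ) - δ • v) := by
      rw [smul_sub _ _ (δ • v), smul_smul, inv_mul_cancel₀ hδ0.ne']
      module
    rw [h3, inner_smul_right]
    refine le_trans (le_of_eq ?_) h2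
    rw [integral_eq_sub_primitive hgCi t, smul_eq_mul]
    field_simp
  linarith

end Limit

/-! ### Existence -/

section Existence

variable {n : ℕ} {T : ℝ} {F : ℝ → EuclideanSpace ℝ (Fin n) → Set (EuclideanSpace ℝ (Fin n))}
  {x₀ : EuclideanSpace ℝ (Fin n)}

theorem exists_isSolution (hT : 0 < T) (hA1 : ∀ t ∈ Icc 0 T, IsMaximalMonotone (F t))
    (hA2 : DomainExcessBound T F) (hA3 : MinimalSectionGrowth T F)
    (hA4 : OuterSemicontinuous T fun t => graph (F t)) (hx₀ : x₀ ∈ dom (F 0)) :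
    ∃ x, IsSolution T F x₀ x := by
  obtain ⟨g, hg, hg0, hscheme⟩ := exists_proximal_scheme hT hA1 hA2 hA3 hA4 hx₀
  choose X τ hX0 hX using fun N : ℕ => hscheme (N + 1) N.succ_pos
  set h : ℕ → ℝ := fun N => T / (N + 1 : ℕ) with hh
  have hhpos : ∀ N, 0 < h N := fun N => div_pos hT (Nat.cast_pos.2 N.succ_pos)
  have hhT : ∀ N, (N + 1 : ℕ) * h N = T := fun N => by
    rw [hh]
    exact mul_div_cancel₀ T (Nat.cast_pos.2 N.succ_pos).ne'
  -- The bounded iterates converge along `U` at every time at once, which replaces an Arzelà–Ascoli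
  -- extraction.
  let U : Ultrafilter ℕ := hyperfilter ℕ
  have hh0 : Tendsto h U (𝓝 0) := by
    refine Tendsto.mono_left ?_ Nat.hyperfilter_le_atTop
    exact (tendsto_const_div_atTop_nhds_zero_nat T).comp (tendsto_add_atTop_nat 1)
  have hinc : ∀ s t, 0 ≤ s → s ≤ t → t ≤ T → ∀ N, ‖X N ⌈t / h N⌉₊ - X N ⌈s / h N⌉₊‖
      ≤ 2 * ∫ r in (s - h N)..(t + h N), g r := by
    intro s t hs hst ht N
    have h1 := Nat.le_ceil (s / h N)
    have h2 := (Nat.ceil_lt_add_one (div_nonneg (hs.trans hst) (hhpos N).le)).le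
    rw [div_le_iff₀ (hhpos N)] at h1
    have h3 := mul_le_mul_of_nonneg_right h2 (hhpos N).le
    rw [add_mul, div_mul_cancel₀ _ (hhpos N).ne', one_mul] at h3
    have hjk : ⌈s / h N⌉₊ ≤ ⌈t / h N⌉₊ :=
      Nat.ceil_mono (div_le_div_of_nonneg_right hst (hhpos N).le)
    have hkN : ⌈t / h N⌉₊ ≤ N + 1 := by
      refine Nat.ceil_le.2 ?_
      rw [div_le_iff₀ (hhpos N), hhT]
      exact ht
    refine ((hX N).norm_sub_le_two_mul hg hg0 (hhpos N).le hjk hkN).trans ?_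
    refine mul_le_mul_of_nonneg_left (integral_le_integral_of_subinterval hg hg0 (by linarith)
      (mul_le_mul_of_nonneg_right ?_ (hhpos N).le) h3) zero_le_two
    have : (⌈s / h N⌉₊ : ℝ) ≤ ⌈t / h N⌉₊ := Nat.cast_le.2 hjk
    linarith
  have hlim : ∀ t, ∃ y, t ∈ Icc 0 T → Tendsto (fun N => X N ⌈t / h N⌉₊) U (𝓝 y) := by
    intro t
    by_cases ht : t ∈ Icc 0 T
    · have hb : ∀ N, X N ⌈t / h N⌉₊ ∈ Metric.closedBall x₀ (2 * ∫ r, g r) := fun N => by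
        have h1 := hinc 0 t le_rfl ht.1 ht.2 N
        rw [zero_div, Nat.ceil_zero, hX0 N] at h1
        rw [mem_closedBall_iff_norm]
        refine h1.trans (mul_le_mul_of_nonneg_left ?_ zero_le_two)
        rw [intervalIntegral.integral_of_le (by linarith [hhpos N, ht.1])]
        exact setIntegral_le_integral hg (Eventually.of_forall hg0)
      obtain ⟨y, -, hy⟩ := (isCompact_closedBall x₀ (2 * ∫ r, g r)).ultrafilter_le_nhds'
        (U.map fun N => X N ⌈t / h N⌉₊) (Ultrafilter.mem_map.2 (univ_mem' hb))
      exact ⟨y, fun _ => hy⟩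
    · exact ⟨0, fun h => absurd h ht⟩
  choose x hx using hlim
  have hxle : ∀ s t, 0 ≤ s → s ≤ t → t ≤ T → ‖x t - x s‖ ≤ 2 * ∫ r in s..t, g r :=
    fun s t hs hst ht => le_of_tendsto_of_tendsto
      ((hx t ⟨hs.trans hst, ht⟩).sub (hx s ⟨hs, hst.trans ht⟩)).norm
      ((tendsto_integral_widened hg hh0 s t).const_mul 2)
      (Eventually.of_forall (hinc s t hs hst ht))
  have hac : AbsolutelyContinuousOnInterval x 0 T := by
    have hgac := (hg.intervalIntegrable (a := 0)
      (b := T)).absolutelyContinuousOnInterval_intervalIntegral left_mem_uIcc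
    refine absolutelyContinuousOnInterval_of_dist_le (K := 2) hgac fun s hs t ht => ?_
    rw [uIcc_of_le hT.le] at hs ht
    rcases le_total s t with hst | hst
    · rw [dist_comm, dist_eq_norm, dist_comm (∫ _ in 0..s, _), Real.dist_eq]
      refine (hxle s t hs.1 hst ht.2).trans (mul_le_mul_of_nonneg_left ?_ zero_le_two)
      rw [integral_eq_sub_primitive hg s t]
      exact le_abs_self _
    · rw [dist_eq_norm, Real.dist_eq]
      refine (hxle t s ht.1 hst hs.2).trans (mul_le_mul_of_nonneg_left ?_ zero_le_two)
      rw [integral_eq_sub_primitive hg t s]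
      exact le_abs_self _
  refine ⟨x, hac, ?_, ?_⟩
  · have h1 := hx 0 ⟨le_rfl, hT.le⟩
    simp only [zero_div, Nat.ceil_zero, hX0] at h1
    exact tendsto_nhds_unique h1 tendsto_const_nhds
  · rw [← restrict_Ioo_eq_restrict_Icc]
    have hdiff : ∀ᵐ t ∂volume.restrict (Ioo 0 T), DifferentiableAt ℝ x t := by
      refine (ae_restrict_iff' measurableSet_Ioo).2 ?_
      filter_upwards [hac.boundedVariationOn.ae_differentiableAt_of_mem_uIcc] with t ht ht'
      exact ht (by rw [uIcc_of_le hT.le]; exact Ioo_subset_Icc_self ht')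
    have hderiv : ∀ᵐ t ∂volume.restrict (Ioo 0 T), ∀ C : ℕ,
        HasDerivAt (fun r => ∫ s in 0..r, max (g s - C) 0) (max (g t - C) 0) t := by
      refine ae_restrict_of_ae (ae_all_iff.2 fun C => ?_)
      filter_upwards [LocallyIntegrable.ae_hasDerivAt_integral
        (integrable_posPart_sub hg hg0 C.cast_nonneg).locallyIntegrable] with t ht
      exact ht 0
    filter_upwards [hdiff, hderiv, ae_restrict_mem measurableSet_Ioo] with t h1 h2 h3
    have h4 := neg_deriv_mem_of_tendsto hA1 hA4 hg hg0 hhpos hhT hh0 hX hx h3 h1.hasDerivAt h2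
    exact ⟨⟨_, h4⟩, h1, h4⟩

end Existence

end MonotoneInclusion

theorem mainTheorem1 (n : ℕ) (T : ℝ) (hT : 0 < T)
    (F : ℝ → EuclideanSpace ℝ (Fin n) → Set (EuclideanSpace ℝ (Fin n)))
    (hA1 : ∀ t ∈ Set.Icc 0 T, MonotoneInclusion.IsMaximalMonotone (F t))
    (hA2 : MonotoneInclusion.DomainExcessBound T F)
    (hA3 : MonotoneInclusion.MinimalSectionGrowth T F)
    (hA4 : MonotoneInclusion.OuterSemicontinuous T (fun t => MonotoneInclusion.graph (F t)))
    (x₀ : EuclideanSpace ℝ (Fin n)) (hx₀ : x₀ ∈ closure (MonotoneInclusion.dom (F 0))) :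
    ∃ x : ℝ → EuclideanSpace ℝ (Fin n), MonotoneInclusion.IsSolution T F x₀ x ∧
      ∀ y : ℝ → EuclideanSpace ℝ (Fin n), MonotoneInclusion.IsSolution T F x₀ y →
        Set.EqOn y x (Set.Icc 0 T) := by
  -- The initial domain is closed, so `x₀` is itself in the domain and the scheme can start there.
  rw [(MonotoneInclusion.isClosed_dom hA1 hA3 hA4 ⟨le_rfl, hT.le⟩).closure_eq] at hx₀
  obtain ⟨x, hx⟩ := MonotoneInclusion.exists_isSolution hT hA1 hA2 hA3 hA4 hx₀
  exact ⟨x, hx, fun y hy =>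
    MonotoneInclusion.IsSolution.eqOn (fun t ht => (hA1 t ht).1) hx hy⟩
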